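/- Let $\mathcal R\neq\emptyset$ and $\mathcal{AR}$ be sets, $\le$ a quasi-order on $\mathcal R$, $\le_{\mathrm{fin}}$ a quasi-order on $\mathcal{AR}$, and $r:\mathcal R\times\omega\to\mathcal{AR}$, $r_n(A)=r(A,n)$. Let $\mathcal{AR}_n=\{r_n(A):A\in\mathcal R\}$ and assume $\mathcal{AR}=\bigcup_n\mathcal{AR}_n$. Write $a\sqsubseteq b$ if $a=r_m(A)$, $b=r_n(A)$ for some $A\in\mathcal R$, $m\le n$; $\mathrm{lh}(a)$ for the $n$ with $a\in\mathcal{AR}_n$; $[a,A]=\{B\in\mathcal R: B\le A,\ \exists n\ r_n(B)=a\}$; $\mathcal{AR}{\upharpoonright}A=\{a:\exists n\ a\le_{\mathrm{fin}}r_n(A)\}$; for $a\in\mathcal{AR}{\upharpoonright}A$, $\mathrm{depth}_A(a)=\min\{n:a\le_{\mathrm{fin}}r_n(A)\}$ and $[\mathrm{depth}_A(a),A]=[r_{\mathrm{depth}_A(a)}(A),A]$; $\mathcal{AR}{\upharpoonright}[a,A]=\{b\in\mathcal{AR}{\upharpoonright}A:a\sqsubseteq b\}$; and $r_n[a,A]=\{b\in\mathcal{AR}{\upharpoonright}[a,A]:\mathrm{lh}(b)=n\}$.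 Assume that $(\mathcal R,\le,r)$ is a closed triple satisfying A1–A4, that is: * **(A1)** $r_0$ is constant; $A\ne B$ implies $r_n(A)\neq r_n(B)$ for some $n$; $r_n(A)=r_m(B)$ implies $n=m$ and $r_k(A)=r_k(B)$ for all $k<n$. * **(closed)** The set $\{(r_n(A))_{n}:A\in\mathcal R\}$, with which $\mathcal R$ is identified, is closed in $\mathcal{AR}^{\mathbb N}$, where $\mathcal{AR}$ is discrete. * **(A2)** $\{a:a\le_{\mathrm{fin}}b\}$ is finite for each $b$; $A\le B$ iff $\forall n\,\exists m\ r_n(A)\le_{\mathrm{fin}}r_m(B)$; if $a\sqsubseteq b\le_{\mathrm{fin}}c$, then $a\le_{\mathrm{fin}}d$ for some $d\sqsubseteq c$. * **(A3)** If $a\in\mathcal{AR}{\upharpoonright}B$, then $[a,A]\ne\emptyset$ for all $A\in[\mathrm{depth}_B(a),B]$; if $A\le B$ and $[a,A]\neq\emptyset$, then $\emptyset\ne[a,A']\subseteq[a,A]$ for some $A'\in[\mathrm{depth}_B(a),B]$. * **(A4)** If $a\in\mathcal{AR}{\upharpoonright}B$ and $\mathcal O\subseteq\mathcal{AR}_{\mathrm{lh}(a)+1}$,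 then for some $A\in[\mathrm{depth}_B(a),B]$ the set $r_{\mathrm{lh}(a)+1}[a,A]$ is contained in $\mathcal O$ or disjoint from $\mathcal O$. Let $\mathcal H\subseteq\mathcal R$ be a coideal: (i) $A\in\mathcal H$, $A\le B$ imply $B\in\mathcal H$; and for all $A\in\mathcal H$, $a\in\mathcal{AR}{\upharpoonright}A$: (ii) $[a,B]\cap\mathcal H\ne\emptyset$ for all $B\in[\mathrm{depth}_A(a),A]\cap\mathcal H$; (iii) if $B\in\mathcal H$, $B\le A$ and $[a,B]\neq\emptyset$, then $\emptyset\ne[a,A']\subseteq[a,B]$ for some $A'\in[\mathrm{depth}_A(a),A]\cap\mathcal H$; (iv) for each $\mathcal O\subseteq\mathcal{AR}_{\mathrm{lh}(a)+1}$ there is $B\in[\mathrm{depth}_A(a),A]\cap\mathcal H$ with $r_{\mathrm{lh}(a)+1}[a,B]$ contained in $\mathcal O$ or disjoint from $\mathcal O$. Assume that $\mathcal H$ is semiselective: whenever $A\in\mathcal H$, $a\in\mathcal{AR}{\upharpoonright}A$, and for each $b\in\mathcal{AR}{\upharpoonright}[a,A]$ we are given a set $\mathcal D_b\subseteq\mathcal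 H\cap[b,A]$ that is $\le$-downward closed in $\mathcal H\cap[b,A]$ and such that every $B\in\mathcal H\cap[b,A]$ has some $C\in\mathcal H\cap[b,B]$ with $C\in\mathcal D_b$, then there is $B\in\mathcal H\cap[a,A]$ such that for each $b\in\mathcal{AR}{\upharpoonright}[a,A]$ there is $A_b\in\mathcal D_b$ with $[b,B]\subseteq[b,A_b]$. Let $\mathbb M_{\mathcal H}=\{(a,A):A\in\mathcal H,\ a\in\mathcal{AR}{\upharpoonright}A\}$, ordered by $(b,B)\le(a,A)$ iff $[b,B]\subseteq[a,A]$, and write $(b,B)\le_0(a,A)$ if moreover $b=a$. All this takes place in the ground model $\mathbf V$. In a generic extension of $\mathbf V$, $\mathcal R$ is read as the closure of $\{(r_n(A))_n:A\in\mathcal R^{\mathbf V}\}$ in $\mathcal{AR}^{\mathbb N}$, and $\le$ as the relation $\forall n\,\exists m\ r_n(A)\le_{\mathrm{fin}}r_m(B)$. An element $A$ of $\mathcal R$ in the extension is *$\mathbb M_{\mathcal H}$-generic over $\mathbf V$* if $G_A=\{(a,B)\in\mathbb M_{\mathcal H}:A\in[a,B]\}$ is a filter that meets every dense subset of $\mathbb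 M_{\mathcal H}$ lying in $\mathbf V$. Then: 1. (Mathias property) In every generic extension of $\mathbf V$ (by any forcing notion), if $A\in\mathcal R$ is $\mathbb M_{\mathcal H}$-generic over $\mathbf V$ and $B\in\mathcal R$ satisfies $B\le A$, then $B$ is $\mathbb M_{\mathcal H}$-generic over $\mathbf V$. (Formally: for every forcing notion $\mathbb Q$, $p\in\mathbb Q$ and $\mathbb Q$-names $\dot A,\dot B$ of sequences in $\mathcal{AR}$, if $p$ forces that $\dot A$ is $\mathbb M_{\mathcal H}$-generic over $\mathbf V$, $\dot B\in\mathcal R$ and $\dot B\le\dot A$, then $p$ forces that $\dot B$ is $\mathbb M_{\mathcal H}$-generic over $\mathbf V$.) 2. (Prikry property) For every sentence $\varphi$ of the forcing language (a first-order formula of set theory with $\mathbb M_{\mathcal H}$-names as parameters) and every $p\in\mathbb M_{\mathcal H}$ there is $q\le_0p$ with $q\Vdash\varphi$ or $q\Vdash\neg\varphi$. No transitivity of an almost-reduction relation $\le^*$ is assumed. -/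

import Mathlib

universe u w

/-! ### Triples `(ℛ, ≤, r)` and the axioms A1–A4 -/

/-- The data of a triple `(ℛ, ≤, r)`, `r : ℛ × ω → 𝒜ℛ`, together with the relation `≤_fin` on `𝒜ℛ`
that axiom A2 speaks of. The laws are stated separately below. -/
structure RamseyTriple (R AR : Type u) where
  /-- the relation `A ≤ B` on `ℛ` -/
  le : R → R → Prop
  /-- the approximation `r_n(A)` -/
  r : R → ℕ → AR
  /-- the relation `a ≤_fin b` on `𝒜ℛ` -/
  leFin : AR → AR → Prop

namespace RamseyTriple

variable {R AR : Type u} (T : RamseyTriple R AR)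

/-- `𝒜ℛ_n`, the image of `r_n`. -/
def level (n : ℕ) : Set AR := {a | ∃ A, T.r A n = a}

/-- The length `lh(a)`: the `n` with `a ∈ 𝒜ℛ_n`
(it exists and is unique for a triple with A1 in which every `a` is an approximation). -/
noncomputable def lh (a : AR) : ℕ := sInf {n | a ∈ T.level n}

/-- `a ⊑ b`: `a` is an initial segment of `b`. -/
def Initial (a b : AR) : Prop := ∃ (A : R) (m n : ℕ), m ≤ n ∧ T.r A m = a ∧ T.r A n = b

/-- The Ellentuck neighbourhood `[a, A]`. -/
def nbhd (a : AR) (A : R) : Set R := {B | T.le B A ∧ ∃ n, T.r B n = a}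

/-- `𝒜ℛ↾A`: the `a` with `a ≤_fin r_n(A)` for some `n`, i.e. those with `depth_A(a) < ∞`. -/
def below (A : R) : Set AR := {a | ∃ n, T.leFin a (T.r A n)}

/-- `depth_B(a)`, the least `n` with `a ≤_fin r_n(B)`. It is only used when such an `n` exists, that
is, when `a ∈ T.below B` (the value `∞` of the other case is never needed). -/
noncomputable def depth (B : R) (a : AR) : ℕ := sInf {n | T.leFin a (T.r B n)}

/-- `[depth_B(a), B] = [r_{depth_B(a)}(B), B]`. -/
def depthNbhd (a : AR) (B : R) : Set R := T.nbhd (T.r B (T.depth B a)) B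

/-- `𝒜ℛ↾[a, A]`: the `b ∈ 𝒜ℛ↾A` that end-extend `a`. -/
def belowNbhd (a : AR) (A : R) : Set AR := {b | b ∈ T.below A ∧ T.Initial a b}

/-- `r_n[a, A]`: the elements of `𝒜ℛ↾[a, A]` of length `n`. -/
def rNbhd (n : ℕ) (a : AR) (A : R) : Set AR := {b | b ∈ T.belowNbhd a A ∧ T.lh b = n}

/-- Axiom A1. In `zero`, the common value of `r_0` is what is called `∅`. -/
structure A1 : Prop where
  zero : ∀ A B, T.r A 0 = T.r B 0
  ext : ∀ A B, A ≠ B → ∃ n, T.r A n ≠ T.r B n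
  coherent : ∀ A B n m, T.r A n = T.r B m → n = m ∧ ∀ k < n, T.r A k = T.r B k

/-- Axiom A2. -/
structure A2 : Prop where
  leFin_refl : ∀ a, T.leFin a a
  leFin_trans : ∀ a b c, T.leFin a b → T.leFin b c → T.leFin a c
  finite : ∀ b, {a | T.leFin a b}.Finite
  le_iff : ∀ A B, T.le A B ↔ ∀ n, ∃ m, T.leFin (T.r A n) (T.r B m)
  initial : ∀ a b c, T.Initial a b → T.leFin b c → ∃ d, T.Initial d c ∧ T.leFin a d

/-- Axiom A3. -/
structure A3 : Prop where
  nonempty : ∀ B, ∀ a ∈ T.below B, ∀ A ∈ T.depthNbhd a B, (T.nbhd a A).Nonempty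
  shrink : ∀ A B a, T.le A B → (T.nbhd a A).Nonempty →
    ∃ A' ∈ T.depthNbhd a B, (T.nbhd a A').Nonempty ∧ T.nbhd a A' ⊆ T.nbhd a A

/-- Axiom A4. -/
def A4 : Prop :=
  ∀ B, ∀ a ∈ T.below B, ∀ O ⊆ T.level (T.lh a + 1), ∃ A ∈ T.depthNbhd a B,
    T.rNbhd (T.lh a + 1) a A ⊆ O ∨ T.rNbhd (T.lh a + 1) a A ⊆ Oᶜ

/-- `ℛ`, identified with a set of sequences through `A ↦ (r_n(A))_n`, is closed in `𝒜ℛ^ℕ`, the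
product of discrete spaces. -/
def MetricallyClosed : Prop :=
  @IsClosed (ℕ → AR) (@Pi.topologicalSpace ℕ (fun _ => AR) (fun _ => ⊥)) (Set.range T.r)

/-- `(ℛ, ≤, r)` is a closed triple that satisfies A1–A4. -/
structure IsClosedRamsey : Prop where
  nonempty : Nonempty R
  le_refl : ∀ A, T.le A A
  le_trans : ∀ A B C, T.le A B → T.le B C → T.le A C
  /-- every element of `𝒜ℛ` is an approximation, i.e. `𝒜ℛ` is the union of the `𝒜ℛ_n` -/
  approx : ∀ a, ∃ n, a ∈ T.level n
  closed : T.MetricallyClosed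
  a1 : T.A1
  a2 : T.A2
  a3 : T.A3
  a4 : T.A4

/-! ### Coideals and semiselectivity -/

/-- `ℋ ⊆ ℛ` is a coideal. -/
structure IsCoideal (H : Set R) : Prop where
  upward : ∀ A B, A ∈ H → T.le A B → B ∈ H
  /-- A3 mod `ℋ`, first part -/
  a3_nonempty : ∀ A ∈ H, ∀ a ∈ T.below A, ∀ B ∈ T.depthNbhd a A ∩ H, (T.nbhd a B ∩ H).Nonempty
  /-- A3 mod `ℋ`, second part -/
  a3_shrink : ∀ A ∈ H, ∀ a ∈ T.below A, ∀ B ∈ H, T.le B A → (T.nbhd a B).Nonempty →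
    ∃ A' ∈ T.depthNbhd a A ∩ H, (T.nbhd a A').Nonempty ∧ T.nbhd a A' ⊆ T.nbhd a B
  /-- A4 mod `ℋ` -/
  a4 : ∀ A ∈ H, ∀ a ∈ T.below A, ∀ O ⊆ T.level (T.lh a + 1), ∃ B ∈ T.depthNbhd a A ∩ H,
    T.rNbhd (T.lh a + 1) a B ⊆ O ∨ T.rNbhd (T.lh a + 1) a B ⊆ Oᶜ

/-- The family `(𝒟_b)`, `b ∈ 𝒜ℛ↾[a, A]`, is dense open below `[a, A]` in `ℋ`
(the values of `D` at other `b` play no role). -/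
structure DenseOpenBelow (H : Set R) (a : AR) (A : R) (D : AR → Set R) : Prop where
  subset : ∀ b ∈ T.belowNbhd a A, D b ⊆ T.nbhd b A ∩ H
  downward : ∀ b ∈ T.belowNbhd a A, ∀ B ∈ D b, ∀ C ∈ T.nbhd b A ∩ H, T.le C B → C ∈ D b
  dense : ∀ b ∈ T.belowNbhd a A, ∀ B ∈ T.nbhd b A ∩ H, ∃ C ∈ T.nbhd b B ∩ H, C ∈ D b

/-- `B ∈ ℋ↾[a, A]` diagonalises the family `(𝒟_b)`, `b ∈ 𝒜ℛ↾[a, A]`. -/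
def Diagonalises (H : Set R) (a : AR) (A : R) (D : AR → Set R) (B : R) : Prop :=
  B ∈ T.nbhd a A ∩ H ∧ ∀ b ∈ T.belowNbhd a A, ∃ C ∈ D b, T.nbhd b B ⊆ T.nbhd b C

/-- `ℋ` is semiselective. -/
def Semiselective (H : Set R) : Prop :=
  ∀ A ∈ H, ∀ a ∈ T.below A, ∀ D : AR → Set R, T.DenseOpenBelow H a A D →
    ∃ B, T.Diagonalises H a A D B

/-! ### The localized abstract Mathias forcing -/

/-- The conditions `(a, A)` of `𝕄_ℋ`: `A ∈ ℋ` and `a ∈ 𝒜ℛ↾A`. -/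
structure Mathias (H : Set R) : Type u where
  stem : AR
  side : R
  side_mem : side ∈ H
  stem_mem : stem ∈ T.below side

/-- `(b, B) ≤ (a, A)` iff `[b, B] ⊆ [a, A]`. -/
instance (H : Set R) : Preorder (T.Mathias H) where
  le q p := T.nbhd q.stem q.side ⊆ T.nbhd p.stem p.side
  le_refl _ := subset_rfl
  le_trans _ _ _ h₁ h₂ := h₁.trans h₂

/-- `(b, B) ≤₀ (a, A)`. -/
def Mathias.LE0 {T : RamseyTriple R AR} {H : Set R} (q p : T.Mathias H) : Prop :=
  q ≤ p ∧ q.stem = p.stem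

end RamseyTriple

/-! ### The forcing language and the forcing relation

The ground model is the universe `Type u`. -/

/-- `P`-names: a name is a (small) set of pairs of a `P`-name and a condition. -/
inductive ForcingName (P : Type u) : Type (u + 1)
  | mk (ι : Type u) (name : ι → ForcingName P) (cond : ι → P) : ForcingName P

namespace ForcingName

variable {P : Type u} [Preorder P]

/-- `ForcesEq σ τ p` is `p ⊩ σ = τ`: below `p`, each pair `(σᵢ, sᵢ)` of `σ` is such that `sᵢ` forces,
together with `p`, that `σᵢ` is a member of `τ`, and conversely. -/
def ForcesEq : ForcingName P → ForcingName P → P → Prop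
  | ⟨ι, x, s⟩, ⟨κ, y, t⟩ => fun p =>
    (∀ i : ι, ∀ q ≤ p, q ≤ s i → ∃ r ≤ q, ∃ j : κ, r ≤ t j ∧ ForcesEq (x i) (y j) r) ∧
    (∀ j : κ, ∀ q ≤ p, q ≤ t j → ∃ r ≤ q, ∃ i : ι, r ≤ s i ∧ ForcesEq (x i) (y j) r)

/-- `ForcesMem σ τ p` is `p ⊩ σ ∈ τ`. -/
def ForcesMem (σ : ForcingName P) : ForcingName P → P → Prop
  | ⟨κ, y, t⟩ => fun p => ∀ q ≤ p, ∃ r ≤ q, ∃ j : κ, r ≤ t j ∧ ForcesEq σ (y j) r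

end ForcingName

namespace SetTheory

/-- The only non-logical symbol of the language of set theory, the binary relation symbol `∈`. -/
inductive MemSymbol : ℕ → Type
  | mem : MemSymbol 2

/-- The first-order language of set theory (equality is a logical symbol). -/
def language : FirstOrder.Language := ⟨fun _ => Empty, MemSymbol⟩

end SetTheory

/-- A sentence of the forcing language for `P`: a first-order formula of set theory in which all
variables that are not bound are replaced by `P`-names. -/
abbrev ForcingSentence (P : Type u) : Type (u + 1) :=
  SetTheory.language.Formula (ForcingName P)

/-- The name that a term denotes, once names are assigned to the variables `0, …, n - 1`. -/
def ForcingName.ofTerm {P : Type u} {n : ℕ} (v : Fin n → ForcingName P) :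
    SetTheory.language.Term (ForcingName P ⊕ Fin n) → ForcingName P
  | .var x => Sum.elim id v x
  | .func f _ => Empty.elim f

/-- The forcing relation `p ⊩ φ`, where `v` assigns names to the variables `0, …, n - 1`. -/
def ForcesFormula {P : Type u} [Preorder P] : {n : ℕ} →
    SetTheory.language.BoundedFormula (ForcingName P) n → (Fin n → ForcingName P) → P → Prop
  | _, .falsum, _, _ => False
  | _, .equal t₁ t₂, v, p => ForcingName.ForcesEq (.ofTerm v t₁) (.ofTerm v t₂) p
  | _, .rel SetTheory.MemSymbol.mem ts, v, p => ForcingName.ForcesMem (.ofTerm v (ts 0)) (.ofTerm v (ts 1)) p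
  | _, .imp φ ψ, v, p => ∀ q ≤ p, ForcesFormula φ v q → ForcesFormula ψ v q
  | _, .all φ, v, p => ∀ σ : ForcingName P, ForcesFormula φ (Fin.snoc v σ) p

/-- `p ⊩ φ` for a sentence `φ` of the forcing language. -/
def Forces {P : Type u} [Preorder P] (p : P) (φ : ForcingSentence P) : Prop :=
  ForcesFormula φ Fin.elim0 p

namespace RamseyTriple

variable {R AR : Type u}

/-- The Prikry property of `𝕄_ℋ`. -/
def PrikryProperty (T : RamseyTriple R AR) (H : Set R) : Prop :=
  ∀ (φ : ForcingSentence (T.Mathias H)) (p : T.Mathias H),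
    ∃ q : T.Mathias H, q.LE0 p ∧ (Forces q φ ∨ Forces q φ.not)

end RamseyTriple

/-! ### Elements of `ℛ` in a generic extension

Let `Q` be a forcing notion in the ground model. A sequence of elements of a ground model set `X` that
lies in a generic extension by `Q` is given by a name for a subset of `ω × X` that consists of pairs
`((n, x)ˇ, q)`. Statements about such sequences are read as forced statements: a statement is given by
the set of conditions that force it, conjunctions and universal quantifiers are pointwise,
`p ⊩ φ → ψ` iff each `q ≤ p` that forces `φ` forces `ψ`, and `p ⊩ ∃ x, φ x` iff it is dense below `p`
to force `φ x` for some `x`. -/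

/-- A `Q`-name for a subset of `ω × X`: `q ∈ τ n x` says that the pair `((n, x)ˇ, q)` is in `τ`. -/
def SeqName (Q : Type w) (X : Type u) : Type (max u w) := ℕ → X → Set Q

namespace SeqName

variable {Q : Type w} [Preorder Q] {X : Type u}

/-- `p ⊩ τ(n) = x`. -/
def ForcesVal (τ : SeqName Q X) (n : ℕ) (x : X) (p : Q) : Prop :=
  ∀ q ≤ p, ∃ r ≤ q, ∃ s ∈ τ n x, r ≤ s

/-- `p ⊩ τ is a function from ω to X`. -/
def ForcesFun (τ : SeqName Q X) (p : Q) : Prop :=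
  (∀ n, ∀ q ≤ p, ∃ r ≤ q, ∃ x, τ.ForcesVal n x r) ∧
  (∀ n x y, ∀ q ≤ p, τ.ForcesVal n x q → τ.ForcesVal n y q → x = y)

/-- The canonical name of the sequence `f` of the ground model. -/
def check (Q : Type w) (f : ℕ → X) : SeqName Q X := fun n x => {_q | f n = x}

end SeqName

namespace RamseyTriple

variable {R AR : Type u} {Q : Type w} [Preorder Q] (T : RamseyTriple R AR)

/-- `p ⊩ Ȧ ∈ ℛ`, where in the extension `ℛ` is the closure of the `ℛ` of the ground model in `𝒜ℛ^ℕ`: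
`Ȧ` is a sequence all of whose finite initial segments are initial segments of some
`(r_n(C))_n` with `C` in the ground model. -/
def ForcesElem (A : SeqName Q AR) (p : Q) : Prop :=
  A.ForcesFun p ∧
    ∀ n, ∀ q ≤ p, ∃ r ≤ q, ∃ C : R, ∀ k ≤ n, A.ForcesVal k (T.r C k) r

/-- `p ⊩ Ḃ ≤ Ȧ`, i.e. `p ⊩ ∀ n ∃ m, r_n(Ḃ) ≤_fin r_m(Ȧ)`. -/
def ForcesLE (B A : SeqName Q AR) (p : Q) : Prop :=
  ∀ n, ∀ q ≤ p, ∃ r ≤ q, ∃ (m : ℕ) (b a : AR),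
    B.ForcesVal n b r ∧ A.ForcesVal m a r ∧ T.leFin b a

/-- `p ⊩ Ȧ ∈ [a, B]`, for `a` and `B` in the ground model. -/
def ForcesNbhd (A : SeqName Q AR) (a : AR) (B : R) (p : Q) : Prop :=
  T.ForcesLE A (.check Q (T.r B)) p ∧ ∀ q ≤ p, ∃ r ≤ q, ∃ n, A.ForcesVal n a r

/-- `p ⊩ s ∈ G_Ȧ`, where `G_Ȧ` is the set of the `(a, B) ∈ 𝕄_ℋ` with `Ȧ ∈ [a, B]`. -/
def ForcesMemG {H : Set R} (A : SeqName Q AR) (s : T.Mathias H) (p : Q) : Prop :=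
  T.ForcesNbhd A s.stem s.side p

/-- `p ⊩ Ȧ is 𝕄_ℋ-generic over the ground model`: `Ȧ ∈ ℛ`, and `G_Ȧ` is a filter on `𝕄_ℋ` that meets
every dense subset of `𝕄_ℋ` in the ground model. -/
structure ForcesGeneric (H : Set R) (A : SeqName Q AR) (p : Q) : Prop where
  elem : T.ForcesElem A p
  nonempty : ∀ q ≤ p, ∃ r ≤ q, ∃ s : T.Mathias H, T.ForcesMemG A s r
  upward : ∀ s t : T.Mathias H, s ≤ t → ∀ q ≤ p, T.ForcesMemG A s q → T.ForcesMemG A t q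
  directed : ∀ s t : T.Mathias H, ∀ q ≤ p, T.ForcesMemG A s q → T.ForcesMemG A t q →
    ∀ q' ≤ q, ∃ r ≤ q', ∃ c : T.Mathias H, c ≤ s ∧ c ≤ t ∧ T.ForcesMemG A c r
  meets : ∀ D : Set (T.Mathias H), (∀ s, ∃ t ≤ s, t ∈ D) →
    ∀ q ≤ p, ∃ r ≤ q, ∃ s ∈ D, T.ForcesMemG A s r

/-- The Mathias property of `𝕄_ℋ`: in every generic extension, by whatever forcing notion `Q`
(of any size), if `A ∈ ℛ` is `𝕄_ℋ`-generic over the ground model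
and `B ∈ ℛ`, `B ≤ A`, then `B` is `𝕄_ℋ`-generic over the ground model. -/
def MathiasProperty (H : Set R) : Prop :=
  ∀ (Q : Type w) [Preorder Q] (A B : SeqName Q AR) (p : Q),
    T.ForcesGeneric H A p → T.ForcesElem B p → T.ForcesLE B A p → T.ForcesGeneric H B p

end RamseyTriple

namespace RamseyTriple

/-! ### Approximations, neighbourhoods and depth -/

section Basic

variable {R AR : Type u} {T : RamseyTriple R AR} {H : Set R} {a b c : AR} {A B C E : R} {m n : ℕ}

/-! Both properties come from one combinatorial forcing argument. Let acceptance be a predicate on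
pairs (stem, side) that is hereditary and passes to a stem from all its one-step extensions.
Semiselectivity decides all stems at once, and A4 mod `H` makes rejection propagate to one-step
extensions. So below any (a, A) some B accepts a or rejects every end-extension of a in 𝒜ℛ↾B
(`exists_accepts_or_forall_rejects`).

Prikry: accept when (c, B) forces φ. The conditions forcing φ form a regular open set; regularity
gives closure under steps, and total rejection means that no stronger condition forces φ.

Mathias: for D dense, accept c when a well-founded tree of approximations above c ends on every
branch in a condition below a member of D (`Captured`). Density rules out total rejection, and
`exists_forall_le_depth` gives densely many conditions whose side captures D at every c of depth at
least some m, whether or not c extends the stem. If A is below such a side, so is B ≤ A. By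
finiteness in A2 some approximation of B has depth at least m, and descending the tree along B,
which is possible in any extension, reaches a member of D whose neighbourhood contains B.
Directedness of the filter then follows by meeting the dense set of conditions that settle two given
ones (`exists_le_or_forces_notMemG`). -/

theorem IsClosedRamsey.lh_r (hT : T.IsClosedRamsey) (A : R) (n : ℕ) : T.lh (T.r A n) = n := by
  have : {k | T.r A n ∈ T.level k} = {n} := by
    ext k
    constructor
    · rintro ⟨B, hB⟩
      exact (hT.a1.coherent _ _ _ _ hB).1
    · rintro rfl
      exact ⟨A, rfl⟩
  rw [lh, this, csInf_singleton]

theorem IsClosedRamsey.r_eq_of_le (hT : T.IsClosedRamsey) (h : T.r A n = T.r B n) (hmn : m ≤ n) :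
    T.r A m = T.r B m := by
  rcases hmn.eq_or_lt with rfl | hlt
  · exact h
  · exact (hT.a1.coherent _ _ _ _ h).2 m hlt

theorem IsClosedRamsey.r_lh (hT : T.IsClosedRamsey) (h : T.r A n = a) : T.r A (T.lh a) = a := by
  subst h
  rw [hT.lh_r]

theorem IsClosedRamsey.mem_nbhd (hT : T.IsClosedRamsey) :
    B ∈ T.nbhd a A ↔ T.le B A ∧ T.r B (T.lh a) = a :=
  ⟨fun h => ⟨h.1, h.2.elim fun _ hn => hT.r_lh hn⟩, fun h => ⟨h.1, _, h.2⟩⟩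

theorem IsClosedRamsey.lh_le (hT : T.IsClosedRamsey) (h : T.Initial a b) : T.lh a ≤ T.lh b := by
  obtain ⟨A, m, n, hmn, rfl, rfl⟩ := h
  rwa [hT.lh_r, hT.lh_r]

theorem IsClosedRamsey.r_of_initial (hT : T.IsClosedRamsey) (h : T.Initial a b)
    (hb : T.r B (T.lh b) = b) : T.r B (T.lh a) = a := by
  obtain ⟨A, m, n, hmn, rfl, rfl⟩ := h
  rw [hT.lh_r] at hb ⊢
  exact hT.r_eq_of_le hb hmn

theorem initial_r (T : RamseyTriple R AR) (A : R) (h : m ≤ n) : T.Initial (T.r A m) (T.r A n) :=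
  ⟨A, m, n, h, rfl, rfl⟩

theorem initial_of_r (ha : T.r A m = a) (hb : T.r A n = b) (h : m ≤ n) : T.Initial a b :=
  ⟨A, m, n, h, ha, hb⟩

theorem nbhd_subset_nbhd_of_le (hT : T.IsClosedRamsey) (h : T.le B A) : T.nbhd a B ⊆ T.nbhd a A :=
  fun _ hC => ⟨hT.le_trans _ _ _ hC.1 h, hC.2⟩

theorem mem_nbhd_of_initial (hT : T.IsClosedRamsey) (h : T.Initial a b) (hB : B ∈ T.nbhd b A) :
    B ∈ T.nbhd a A :=
  ⟨hB.1, _, hT.r_of_initial h (hT.mem_nbhd.1 hB).2⟩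

theorem r_mem_below (hT : T.IsClosedRamsey) (h : T.le B A) (n : ℕ) : T.r B n ∈ T.below A :=
  (hT.a2.le_iff _ _).1 h n

theorem mem_below_of_mem_nbhd (hT : T.IsClosedRamsey) (h : B ∈ T.nbhd a A) : a ∈ T.below A := by
  obtain ⟨h, n, rfl⟩ := h
  exact r_mem_below hT h n

theorem below_mono (hT : T.IsClosedRamsey) (h : T.le B A) : T.below B ⊆ T.below A := by
  rintro a ⟨n, hn⟩
  obtain ⟨m, hm⟩ := r_mem_below hT h n
  exact ⟨m, hT.a2.leFin_trans _ _ _ hn hm⟩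

theorem mem_below_of_initial (hT : T.IsClosedRamsey) (h : T.Initial a b) (hb : b ∈ T.below A) :
    a ∈ T.below A := by
  obtain ⟨n, hn⟩ := hb
  obtain ⟨d, hd, had⟩ := hT.a2.initial _ _ _ h hn
  have := hT.r_of_initial hd (by rw [hT.lh_r])
  exact ⟨_, this ▸ had⟩

theorem rNbhd_mono (hT : T.IsClosedRamsey) (h : T.le B A) : T.rNbhd n a B ⊆ T.rNbhd n a A :=
  fun _ hb => ⟨⟨below_mono hT h hb.1.1, hb.1.2⟩, hb.2⟩

theorem leFin_r_depth (h : a ∈ T.below A) : T.leFin a (T.r A (T.depth A a)) :=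
  Nat.sInf_mem (s := {n | T.leFin a (T.r A n)}) h

theorem self_mem_depthNbhd (hT : T.IsClosedRamsey) (a : AR) (A : R) : A ∈ T.depthNbhd a A :=
  ⟨hT.le_refl _, _, rfl⟩

/-- By A1, agreement at `n` forces agreement below `n`, so depth `n` can be read off the `n`-th
approximation. Fusion uses this to keep what was arranged at a given depth. -/
theorem depth_eq_of_r_eq (hT : T.IsClosedRamsey) (hAB : T.r A n = T.r B n) (h : a ∈ T.below A)
    (hn : T.depth A a = n) : a ∈ T.below B ∧ T.depth B a = n := by
  have h1 : T.leFin a (T.r B n) := by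
    rw [← hAB, ← hn]
    exact leFin_r_depth h
  have h2 : a ∈ T.below B := ⟨n, h1⟩
  refine ⟨h2, le_antisymm (Nat.sInf_le h1) ?_⟩
  by_contra! hlt
  have h3 := leFin_r_depth h2
  rw [← hT.r_eq_of_le hAB hlt.le] at h3
  have : T.depth A a ≤ T.depth B a := Nat.sInf_le h3
  omega

theorem exists_mem_nbhd_inter (hT : T.IsClosedRamsey) (hH : T.IsCoideal H) (hA : A ∈ H)
    (ha : a ∈ T.below A) : ∃ E ∈ H, E ∈ T.nbhd a A := by
  obtain ⟨E, hE⟩ := hH.a3_nonempty A hA a ha A ⟨self_mem_depthNbhd hT a A, hA⟩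
  exact ⟨E, hE.2, hE.1⟩

/-- Inclusion of neighbourhoods passes to end-extensions of the stem. -/
theorem nbhd_subset_of_initial (hT : T.IsClosedRamsey) (h : T.Initial a b)
    (hs : T.nbhd a B ⊆ T.nbhd a A) : T.nbhd b B ⊆ T.nbhd b A :=
  fun _ hE => ⟨(hs (mem_nbhd_of_initial hT h hE)).1, hE.2⟩

/-- Inclusion of neighbourhoods does not give `B ≤ A`; A3 mod `H` supplies an element of `[b, B]`,
which the inclusion carries below `A`. -/
theorem mem_below_of_nbhd_subset (hT : T.IsClosedRamsey) (hH : T.IsCoideal H) (hB : B ∈ H)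
    (h : T.Initial a b) (hs : T.nbhd a B ⊆ T.nbhd a A) (hb : b ∈ T.below B) : b ∈ T.below A := by
  obtain ⟨E, -, hE⟩ := exists_mem_nbhd_inter hT hH hB hb
  exact mem_below_of_mem_nbhd hT (nbhd_subset_of_initial hT h hs hE)

theorem Initial.trans (hT : T.IsClosedRamsey) (hab : T.Initial a b) (hbc : T.Initial b c) :
    T.Initial a c := by
  obtain ⟨A, m, n, hmn, hb, hc⟩ := id hbc
  have hb' := hT.r_of_initial hab (hT.r_lh hb)
  have h1 := hT.lh_le hab
  have h2 := hT.lh_le hbc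
  exact ⟨A, _, _, h1.trans h2, hb', hT.r_lh hc⟩

theorem Initial.refl (hT : T.IsClosedRamsey) (a : AR) : T.Initial a a := by
  obtain ⟨n, A, hA⟩ := hT.approx a
  exact ⟨A, n, n, le_rfl, hA, hA⟩

end Basic

/-! ### The combinatorial forcing -/

section Galvin

variable {R AR : Type u} {T : RamseyTriple R AR} {H : Set R}

/-- `U` passes to conditions with the same stem and a smaller neighbourhood. -/
def Hereditary (T : RamseyTriple R AR) (H : Set R) (U : AR → R → Prop) : Prop :=
  ∀ c B B', B' ∈ H → c ∈ T.below B' → T.nbhd c B' ⊆ T.nbhd c B → U c B → U c B'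

/-- `U` holds at a condition as soon as it holds at all one-step extensions of its stem. -/
def StepClosed (T : RamseyTriple R AR) (H : Set R) (U : AR → R → Prop) : Prop :=
  ∀ b C, C ∈ H → b ∈ T.below C → (∀ c ∈ T.rNbhd (T.lh b + 1) b C, U c C) → U b C

/-- `B` rejects `b`: no `C` in `ℋ ∩ [b, B]` accepts `b`. -/
def Rejects (T : RamseyTriple R AR) (H : Set R) (U : AR → R → Prop) (b : AR) (B : R) : Prop :=
  ∀ C ∈ H, C ∈ T.nbhd b B → ¬ U b C

variable {U : AR → R → Prop}

theorem Rejects.mono {b : AR} {B C : R} (h : T.Rejects H U b B) (hs : T.nbhd b C ⊆ T.nbhd b B) :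
    T.Rejects H U b C :=
  fun E hE hEC => h E hE (hs hEC)

/-- If nothing in `[b, C] ∩ H` accepts, `C` itself rejects, so deciding is dense. Both verdicts pass
to smaller neighbourhoods, so semiselectivity applies. -/
theorem exists_decides (hT : T.IsClosedRamsey) (hsel : T.Semiselective H)
    (hU : T.Hereditary H U) {A : R} (hA : A ∈ H) {a : AR} (ha : a ∈ T.below A) :
    ∃ B ∈ H, B ∈ T.nbhd a A ∧
      ∀ b ∈ T.belowNbhd a A, b ∈ T.below B → U b B ∨ T.Rejects H U b B := by
  obtain ⟨B, ⟨hB, hBH⟩, hdiag⟩ := hsel A hA a ha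
    (fun b => {C | C ∈ T.nbhd b A ∩ H ∧ (U b C ∨ T.Rejects H U b C)})
    { subset := fun b _ C hC => hC.1
      downward := by
        rintro b - C ⟨-, hC⟩ C' hC' hle
        have hs := nbhd_subset_nbhd_of_le (a := b) hT hle
        refine ⟨hC', hC.imp (fun h => ?_) fun h => h.mono hs⟩
        exact hU b C C' hC'.2 (mem_below_of_mem_nbhd hT ⟨hT.le_refl C', hC'.1.2⟩) hs h
      dense := by
        rintro b - C ⟨hC, hCH⟩
        by_cases h : ∃ C' ∈ H, C' ∈ T.nbhd b C ∧ U b C'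
        · obtain ⟨C', hC'H, hC', hUC⟩ := h
          exact ⟨C', ⟨hC', hC'H⟩, ⟨nbhd_subset_nbhd_of_le hT hC.1 hC', hC'H⟩, Or.inl hUC⟩
        · push Not at h
          exact ⟨C, ⟨⟨hT.le_refl C, hC.2⟩, hCH⟩, ⟨hC, hCH⟩, Or.inr h⟩ }
  refine ⟨B, hBH, hB, fun b hb hbB => ?_⟩
  obtain ⟨C, ⟨-, hC⟩, hs⟩ := hdiag b hb
  exact hC.imp (fun h => hU b C B hBH hbB hs h) fun h => h.mono hs

/-- A4 mod `H` makes the one-step extensions of `b` all rejected or all not rejected. In the second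
case they are all accepted, hence so is `b`, against its rejection. Verdicts refer to the fixed side
`B` throughout. -/
theorem exists_step_rejects (hT : T.IsClosedRamsey) (hH : T.IsCoideal H) (hsel : T.Semiselective H)
    (hU : T.Hereditary H U) (hstep : T.StepClosed H U) {B : R} (hB : B ∈ H) {a : AR}
    (ha : a ∈ T.below B)
    (hdec : ∀ b ∈ T.belowNbhd a B, U b B ∨ T.Rejects H U b B) :
    ∃ C ∈ H, C ∈ T.nbhd a B ∧ ∀ b ∈ T.belowNbhd a C, T.Rejects H U b B →
      ∀ c ∈ T.rNbhd (T.lh b + 1) b C, T.Rejects H U c B := by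
  obtain ⟨C, ⟨hC, hCH⟩, hdiag⟩ := hsel B hB a ha
    (fun b => {C | C ∈ T.nbhd b B ∩ H ∧
      (T.Rejects H U b B → ∀ c ∈ T.rNbhd (T.lh b + 1) b C, T.Rejects H U c B)})
    { subset := fun b _ C hC => hC.1
      downward := by
        rintro b - C ⟨-, hC⟩ C' hC' hle
        exact ⟨hC', fun hr c hc => hC hr c (rNbhd_mono hT hle hc)⟩
      dense := by
        rintro b hb B' ⟨hB', hB'H⟩
        have hbB' : b ∈ T.below B' := mem_below_of_mem_nbhd hT ⟨hT.le_refl B', hB'.2⟩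
        obtain ⟨C, ⟨hCd, hCH⟩, hO⟩ := hH.a4 B' hB'H b hbB'
          {c | c ∈ T.level (T.lh b + 1) ∧ T.Rejects H U c B} fun _ h => h.1
        -- `C` agrees with `B'` only up to the depth of `b` and need not start with `b`; `E` does.
        obtain ⟨E, hE, hEH⟩ := hH.a3_nonempty B' hB'H b hbB' C ⟨hCd, hCH⟩
        have hEB' := nbhd_subset_nbhd_of_le hT hCd.1 hE
        have hEB := nbhd_subset_nbhd_of_le hT hB'.1 hEB'
        refine ⟨E, ⟨hEB', hEH⟩, ⟨hEB, hEH⟩, fun hr c hc => ?_⟩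
        have hcC := rNbhd_mono hT hE.1 hc
        rcases hO with hO | hO
        · exact (hO hcC).2
        · have hCB := hT.le_trans _ _ _ hCd.1 hB'.1
          have hbC := mem_below_of_mem_nbhd hT hE
          have hUC : U b C := hstep b C hCH hbC fun d hd => by
            have hdB : d ∈ T.belowNbhd a B :=
              ⟨below_mono hT hCB hd.1.1, hb.2.trans hT hd.1.2⟩
            have hlev : d ∈ T.level (T.lh b + 1) := by
              obtain ⟨n, F, hF⟩ := hT.approx d
              exact ⟨F, hd.2 ▸ hT.r_lh hF⟩
            refine hU d B C hCH hd.1.1 (nbhd_subset_nbhd_of_le hT hCB) ?_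
            exact (hdec d hdB).resolve_right fun h => hO hd ⟨hlev, h⟩
          have hUE := hU b C E hEH (mem_below_of_mem_nbhd hT ⟨hT.le_refl E, hE.2⟩)
            (nbhd_subset_nbhd_of_le hT hE.1) hUC
          exact (hr E hEH hEB hUE).elim }
  refine ⟨C, hCH, hC, fun b hb hr c hc => ?_⟩
  obtain ⟨D, ⟨hD, hDr⟩, hs⟩ := hdiag b ⟨below_mono hT hC.1 hb.1, hb.2⟩
  exact hDr hr c ⟨⟨mem_below_of_nbhd_subset hT hH hCH hc.1.2 hs hc.1.1, hc.1.2⟩, hc.2⟩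

/-- Galvin's lemma mod a semiselective coideal. -/
theorem exists_accepts_or_forall_rejects (hT : T.IsClosedRamsey) (hH : T.IsCoideal H)
    (hsel : T.Semiselective H) (hU : T.Hereditary H U) (hstep : T.StepClosed H U)
    {A : R} (hA : A ∈ H) {a : AR} (ha : a ∈ T.below A) :
    ∃ B ∈ H, B ∈ T.nbhd a A ∧ (U a B ∨ ∀ b ∈ T.belowNbhd a B, T.Rejects H U b B) := by
  obtain ⟨B, hBH, hB, hdec⟩ := exists_decides hT hsel hU hA ha
  have haB : a ∈ T.below B := mem_below_of_mem_nbhd hT ⟨hT.le_refl B, hB.2⟩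
  rcases hdec a ⟨ha, .refl hT a⟩ haB with hacc | hrej
  · exact ⟨B, hBH, hB, Or.inl hacc⟩
  obtain ⟨C, hCH, hC, hCr⟩ := exists_step_rejects hT hH hsel hU hstep hBH haB
    fun b hb => hdec b ⟨below_mono hT hB.1 hb.1, hb.2⟩ hb.1
  refine ⟨C, hCH, nbhd_subset_nbhd_of_le hT hB.1 hC, Or.inr fun b hb => ?_⟩
  refine Rejects.mono ?_ (nbhd_subset_nbhd_of_le hT hC.1)
  obtain ⟨E, -, hE⟩ := exists_mem_nbhd_inter hT hH hCH hb.1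
  have hEb := (hT.mem_nbhd.1 hE).2
  have hEa := hT.r_of_initial hb.2 hEb
  -- Rejection climbs from `a` to `b` along the approximations of the single witness `E`.
  have key : ∀ k, T.Rejects H U (T.r E (T.lh a + k)) B := by
    intro k
    induction k with
    | zero => simpa only [add_zero, hEa] using hrej
    | succ k ih =>
      refine hCr _ ⟨r_mem_below hT hE.1 _, initial_of_r hEa rfl (by omega)⟩ ih _
        ⟨⟨r_mem_below hT hE.1 _, T.initial_r E (by omega)⟩, ?_⟩
      rw [hT.lh_r, hT.lh_r, add_assoc]
  have := key (T.lh b - T.lh a)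
  rwa [Nat.add_sub_cancel' (hT.lh_le hb.2), hEb] at this

/-- A condition below `(a, B)` is refined by one whose stem end-extends `a`. -/
theorem exists_refinement (hT : T.IsClosedRamsey) (hH : T.IsCoideal H) {a : AR} {B : R}
    {D : R} {d : AR} (hD : D ∈ H) (hd : d ∈ T.below D) (hs : T.nbhd d D ⊆ T.nbhd a B) :
    ∃ E ∈ H, E ∈ T.nbhd d D ∧ ∃ b ∈ T.belowNbhd a B, E ∈ T.nbhd b B ∧ T.Initial d b := by
  obtain ⟨E, hEH, hE⟩ := exists_mem_nbhd_inter hT hH hD hd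
  have hEB := hT.mem_nbhd.1 (hs hE)
  refine ⟨E, hEH, hE, T.r E (max (T.lh a) (T.lh d)),
    ⟨r_mem_below hT hEB.1 _, initial_of_r hEB.2 rfl (le_max_left _ _)⟩, ⟨hEB.1, _, rfl⟩,
    initial_of_r (hT.mem_nbhd.1 hE).2 rfl (le_max_right _ _)⟩

end Galvin

end RamseyTriple

/-! ### The forcing relation -/

section Forcing

variable {P : Type u} [Preorder P]

theorem ForcingName.ForcesEq.mono {σ τ : ForcingName P} {p q : P} (hqp : q ≤ p)
    (h : ForcesEq σ τ p) : ForcesEq σ τ q := by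
  cases σ
  cases τ
  rw [ForcesEq] at h ⊢
  exact ⟨fun i r hr => h.1 i r (hr.trans hqp), fun j r hr => h.2 j r (hr.trans hqp)⟩

theorem ForcingName.ForcesEq.of_dense {σ τ : ForcingName P} {p : P}
    (h : ∀ q ≤ p, ∃ r ≤ q, ForcesEq σ τ r) : ForcesEq σ τ p := by
  cases σ
  cases τ
  rw [ForcesEq]
  constructor
  · intro i q hq hqs
    obtain ⟨r, hr, hf⟩ := h q hq
    rw [ForcesEq] at hf
    obtain ⟨r', hr', hj⟩ := hf.1 i r le_rfl (hr.trans hqs)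
    exact ⟨r', hr'.trans hr, hj⟩
  · intro j q hq hqt
    obtain ⟨r, hr, hf⟩ := h q hq
    rw [ForcesEq] at hf
    obtain ⟨r', hr', hi⟩ := hf.2 j r le_rfl (hr.trans hqt)
    exact ⟨r', hr'.trans hr, hi⟩

theorem ForcingName.ForcesMem.mono {σ τ : ForcingName P} {p q : P} (hqp : q ≤ p)
    (h : ForcesMem σ τ p) : ForcesMem σ τ q := by
  cases τ
  exact fun r hr => h r (hr.trans hqp)

theorem ForcingName.ForcesMem.of_dense {σ τ : ForcingName P} {p : P}
    (h : ∀ q ≤ p, ∃ r ≤ q, ForcesMem σ τ r) : ForcesMem σ τ p := by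
  cases τ
  intro q hq
  obtain ⟨r, hr, hf⟩ := h q hq
  obtain ⟨r', hr', hj⟩ := hf r le_rfl
  exact ⟨r', hr'.trans hr, hj⟩

theorem ForcesFormula.mono {n : ℕ} {φ : SetTheory.language.BoundedFormula (ForcingName P) n} :
    ∀ {v : Fin n → ForcingName P} {p q : P}, q ≤ p → ForcesFormula φ v p → ForcesFormula φ v q := by
  induction φ with
  | falsum => exact fun _ h => h
  | equal t₁ t₂ => exact fun hqp h => ForcingName.ForcesEq.mono hqp h
  | rel s ts =>
    cases s
    exact fun hqp h => ForcingName.ForcesMem.mono hqp h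
  | imp φ ψ _ _ => exact fun hqp h r hr => h r (hr.trans hqp)
  | all φ ih => exact fun hqp h σ => ih hqp (h σ)

/-- With monotonicity, this makes the conditions forcing a formula a regular open set. -/
theorem ForcesFormula.of_dense {n : ℕ} {φ : SetTheory.language.BoundedFormula (ForcingName P) n} :
    ∀ {v : Fin n → ForcingName P} {p : P}, (∀ q ≤ p, ∃ r ≤ q, ForcesFormula φ v r) →
      ForcesFormula φ v p := by
  induction φ with
  | falsum => exact fun {_ p} h => (h p le_rfl).elim fun _ h => h.2
  | equal t₁ t₂ => exact fun h => ForcingName.ForcesEq.of_dense h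
  | rel s ts =>
    cases s
    exact fun h => ForcingName.ForcesMem.of_dense h
  | imp φ ψ _ ih =>
    intro v p h q hq hφ
    refine ih fun q' hq' => ?_
    obtain ⟨r, hr, hf⟩ := h q' (hq'.trans hq)
    exact ⟨r, hr, hf r le_rfl (hφ.mono (hr.trans hq'))⟩
  | all φ ih =>
    intro v p h σ
    refine ih fun q hq => ?_
    obtain ⟨r, hr, hf⟩ := h q hq
    exact ⟨r, hr, hf σ⟩

end Forcing

namespace RamseyTriple

/-! ### The Prikry property -/

section Prikry

variable {R AR : Type u} {T : RamseyTriple R AR} {H : Set R}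

/-- The Prikry property for regular open sets of conditions. -/
theorem exists_LE0_mem_or_forall_notMem (hT : T.IsClosedRamsey) (hH : T.IsCoideal H)
    (hsel : T.Semiselective H) (S : Set (T.Mathias H)) (hopen : ∀ p ∈ S, ∀ q ≤ p, q ∈ S)
    (hreg : ∀ p, (∀ q ≤ p, ∃ r ≤ q, r ∈ S) → p ∈ S) (p : T.Mathias H) :
    ∃ q : T.Mathias H, q.LE0 p ∧ (q ∈ S ∨ ∀ r ≤ q, r ∉ S) := by
  obtain ⟨B, hBH, hB, h⟩ := exists_accepts_or_forall_rejects
    (U := fun c B => ∃ (hB : B ∈ H) (hc : c ∈ T.below B), (⟨c, B, hB, hc⟩ : T.Mathias H) ∈ S)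
    hT hH hsel
    (by
      rintro c B B' hB' hc hs ⟨_, _, hS⟩
      exact ⟨hB', hc, hopen _ hS _ hs⟩)
    (by
      intro b C hC hb h
      refine ⟨hC, hb, hreg _ fun q hq => ?_⟩
      obtain ⟨E, hEH, hE⟩ := exists_mem_nbhd_inter hT hH q.side_mem q.stem_mem
      have hEb : T.le E C ∧ T.r E (T.lh b) = b := hT.mem_nbhd.1 (hq hE)
      have hEq := hT.mem_nbhd.1 hE
      obtain ⟨_, _, hS⟩ := h (T.r E (T.lh b + 1)) ⟨⟨r_mem_below hT hEb.1 _,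
        initial_of_r hEb.2 rfl (by omega)⟩, hT.lh_r _ _⟩
      -- A stem long enough to extend both that of `q` and the accepted one-step extension, so the
      -- condition lies below both; regularity then gives closure under steps.
      refine ⟨⟨T.r E (max (T.lh b + 1) (T.lh q.stem)), E, hEH, r_mem_below hT (hT.le_refl E) _⟩,
        fun F hF => ?_, hopen _ hS _ fun F hF => ?_⟩
      · exact nbhd_subset_nbhd_of_le hT hEq.1
          (mem_nbhd_of_initial hT (initial_of_r hEq.2 rfl (le_max_right _ _)) hF)
      · exact nbhd_subset_nbhd_of_le hT hEb.1
          (mem_nbhd_of_initial hT (T.initial_r E (le_max_left _ _)) hF))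
    p.side_mem p.stem_mem
  have hpB : p.stem ∈ T.below B := mem_below_of_mem_nbhd hT ⟨hT.le_refl B, hB.2⟩
  refine ⟨⟨p.stem, B, hBH, hpB⟩, ⟨nbhd_subset_nbhd_of_le hT hB.1, rfl⟩, ?_⟩
  rcases h with ⟨_, _, h⟩ | h
  · exact Or.inl h
  refine Or.inr fun r hr hrS => ?_
  obtain ⟨E, hEH, hE, b, hb, hEB, hrb⟩ := exists_refinement hT hH r.side_mem r.stem_mem hr
  refine h b hb E hEH hEB ⟨hEH, mem_below_of_mem_nbhd hT ⟨hT.le_refl E, hEB.2⟩,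
    hopen r hrS _ fun F hF => ?_⟩
  exact nbhd_subset_nbhd_of_le hT hE.1 (mem_nbhd_of_initial hT hrb hF)

theorem prikryProperty (hT : T.IsClosedRamsey) (hH : T.IsCoideal H) (hsel : T.Semiselective H) :
    T.PrikryProperty H := by
  intro φ p
  -- Forcing a negation unfolds to the second alternative: no stronger condition forces `φ`.
  exact exists_LE0_mem_or_forall_notMem hT hH hsel {p | Forces p φ}
    (fun _ hp _ hq => ForcesFormula.mono hq hp) (fun _ hp => ForcesFormula.of_dense hp) p

end Prikry

/-! ### Capturing -/

section Captured

variable {R AR : Type u} {T : RamseyTriple R AR} {H : Set R} {P : AR → R → Prop}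

/-- Every sequence that starts with `c` and stays below `B` has an initial segment at or above `c`
that satisfies `P`; the statement is given by a well-founded tree, which makes it absolute. -/
inductive Captured (T : RamseyTriple R AR) (P : AR → R → Prop) (B : R) : AR → Prop
  | base (c : AR) : P c B → Captured T P B c
  | step (c : AR) : (∀ c' ∈ T.rNbhd (T.lh c + 1) c B, Captured T P B c') → Captured T P B c

/-- The same tree works after restriction: one-step extensions available below `B'` are available
below `B`, and inclusion of neighbourhoods passes to them. -/
theorem Captured.hereditary (hT : T.IsClosedRamsey) (hH : T.IsCoideal H)
    (hP : T.Hereditary H P) : T.Hereditary H fun c B => T.Captured P B c := by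
  intro c B B' hB' hc hs h
  induction h with
  | base c h => exact .base c (hP c B B' hB' hc hs h)
  | step c _ ih =>
    refine .step c fun c' hc' => ?_
    have hi := hc'.1.2
    exact ih c' ⟨⟨mem_below_of_nbhd_subset hT hH hB' hi hs hc'.1.1, hi⟩, hc'.2⟩ hc'.1.1
      (nbhd_subset_of_initial hT hi hs)

theorem Captured.stepClosed : T.StepClosed H fun c B => T.Captured P B c :=
  fun b _ _ _ h => .step b h

theorem exists_captured_or (hT : T.IsClosedRamsey) (hH : T.IsCoideal H)
    (hsel : T.Semiselective H) (hP : T.Hereditary H P) {A : R} (hA : A ∈ H) {a : AR}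
    (ha : a ∈ T.below A) :
    ∃ B ∈ H, B ∈ T.nbhd a A ∧ (T.Captured P B a ∨
      ∀ b ∈ T.belowNbhd a B, ∀ C ∈ H, C ∈ T.nbhd b B → ¬ P b C) := by
  obtain ⟨B, hBH, hB, h⟩ := exists_accepts_or_forall_rejects hT hH hsel
    (Captured.hereditary hT hH hP) Captured.stepClosed hA ha
  exact ⟨B, hBH, hB, h.imp_right fun h b hb C hC hCB hPC => h b hb C hC hCB (.base b hPC)⟩

/-- Diagonalisation over all `c` that are not below a given initial segment of `A`. -/
theorem exists_forall_le_depth (hT : T.IsClosedRamsey) (hH : T.IsCoideal H)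
    (hsel : T.Semiselective H) (hP : T.Hereditary H P)
    (hdense : ∀ A ∈ H, ∀ c ∈ T.below A, ∃ B ∈ H, B ∈ T.nbhd c A ∧ P c B)
    {A : R} (hA : A ∈ H) (m : ℕ) :
    ∃ B ∈ H, B ∈ T.nbhd (T.r A m) A ∧ ∀ c ∈ T.below B, m ≤ T.depth B c → P c B := by
  obtain ⟨B, ⟨hB, hBH⟩, hdiag⟩ := hsel A hA (T.r A m) (r_mem_below hT (hT.le_refl A) m)
    -- Stage `b` treats only the `c` of depth exactly `lh b`. These satisfy `c ≤_fin b`, so A2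
    -- leaves finitely many.
    (fun b => {C | C ∈ T.nbhd b A ∩ H ∧ ∀ c ∈ T.below C, T.depth C c = T.lh b → P c C})
    { subset := fun b _ C hC => hC.1
      downward := by
        rintro b - C ⟨⟨hC, -⟩, hCP⟩ C' ⟨hC', hC'H⟩ hle
        refine ⟨⟨hC', hC'H⟩, fun c hc hcd => ?_⟩
        obtain ⟨h1, h2⟩ := depth_eq_of_r_eq hT
          ((hT.mem_nbhd.1 hC').2.trans (hT.mem_nbhd.1 hC).2.symm) hc hcd
        exact hP c C C' hC'H hc (nbhd_subset_nbhd_of_le hT hle) (hCP c h1 h2)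
      dense := by
        rintro b - C ⟨hC, hCH⟩
        have hCb := (hT.mem_nbhd.1 hC).2
        have key : ∀ S : Set AR, S.Finite → ∃ C' ∈ H, C' ∈ T.nbhd b C ∧
            ∀ c ∈ S, c ∈ T.below C' → T.depth C' c = T.lh b → P c C' := by
          intro S hS
          induction S, hS using Set.Finite.induction_on with
          | empty => exact ⟨C, hCH, ⟨hT.le_refl C, hC.2⟩, fun c hc => hc.elim⟩
          | @insert e S _ _ ih =>
            obtain ⟨C₁, hC₁H, hC₁, hC₁P⟩ := ih
            have hC₁b := (hT.mem_nbhd.1 hC₁).2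
            by_cases he : e ∈ T.below C₁ ∧ T.depth C₁ e = T.lh b
            · obtain ⟨C₂, hC₂H, hC₂, hC₂P⟩ := hdense C₁ hC₁H e he.1
              -- `C₂` may no longer start with `b`. A3 mod `H` replaces it by `C₃`, which does, with
              -- `[e, C₃] ⊆ [e, C₂]`; this is why heredity is stated for inclusion of
              -- neighbourhoods.
              obtain ⟨C₃, ⟨hC₃, hC₃H⟩, -, hs⟩ := hH.a3_shrink C₁ hC₁H e he.1 C₂ hC₂H hC₂.1
                ⟨C₂, hT.le_refl C₂, hC₂.2⟩
              rw [depthNbhd, he.2, hC₁b] at hC₃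
              have hC₃b := (hT.mem_nbhd.1 hC₃).2
              refine ⟨C₃, hC₃H, nbhd_subset_nbhd_of_le hT hC₁.1 hC₃, ?_⟩
              rintro c (rfl | hc) hc₃ hd
              · exact hP c C₂ C₃ hC₃H hc₃ hs hC₂P
              · obtain ⟨h1, h2⟩ := depth_eq_of_r_eq hT (hC₃b.trans hC₁b.symm) hc₃ hd
                exact hP c C₁ C₃ hC₃H hc₃ (nbhd_subset_nbhd_of_le hT hC₃.1) (hC₁P c hc h1 h2)
            · refine ⟨C₁, hC₁H, hC₁, ?_⟩
              rintro c (rfl | hc) hc₁ hd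
              · exact (he ⟨hc₁, hd⟩).elim
              · exact hC₁P c hc hc₁ hd
        obtain ⟨C', hC'H, hC', h⟩ := key {c | T.leFin c b} (hT.a2.finite b)
        refine ⟨C', ⟨hC', hC'H⟩, ⟨nbhd_subset_nbhd_of_le hT hC.1 hC', hC'H⟩,
          fun c hc hd => h c ?_ hc hd⟩
        have := leFin_r_depth hc
        rwa [hd, (hT.mem_nbhd.1 hC').2] at this }
  refine ⟨B, hBH, hB, fun c hc hd => ?_⟩
  have hBm := (hT.mem_nbhd.1 hB).2
  rw [hT.lh_r] at hBm
  obtain ⟨C, ⟨⟨hC, -⟩, hCP⟩, hs⟩ := hdiag (T.r B (T.depth B c))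
    ⟨r_mem_below hT hB.1 _, initial_of_r hBm rfl hd⟩
  have hBC := (hs ⟨hT.le_refl B, _, rfl⟩).1
  have hCB := (hT.mem_nbhd.1 hC).2
  rw [hT.lh_r] at hCB
  obtain ⟨h1, h2⟩ := depth_eq_of_r_eq hT hCB.symm hc rfl
  exact hP c C B hBH hc (nbhd_subset_nbhd_of_le hT hBC) (hCP c h1 (h2.trans (hT.lh_r _ _).symm))

end Captured

end RamseyTriple

/-! ### Sequences in a generic extension -/

namespace SeqName

variable {Q : Type w} [Preorder Q] {X : Type u} {τ : SeqName Q X} {n : ℕ} {x : X} {p q : Q}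

theorem ForcesVal.mono (hqp : q ≤ p) (h : τ.ForcesVal n x p) : τ.ForcesVal n x q :=
  fun r hr => h r (hr.trans hqp)

theorem forcesVal_check {f : ℕ → X} : (check Q f).ForcesVal n x p ↔ f n = x := by
  constructor
  · intro h
    obtain ⟨_, _, _, hs, _⟩ := h p le_rfl
    exact hs
  · exact fun h q _ => ⟨q, le_rfl, q, h, le_rfl⟩

end SeqName

namespace RamseyTriple

section Extension

variable {R AR : Type u} {Q : Type w} [Preorder Q] {T : RamseyTriple R AR} {H : Set R}
  {A A' : SeqName Q AR} {B : R} {a b c : AR} {m n : ℕ} {p q : Q}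

theorem ForcesElem.mono (hqp : q ≤ p) (h : T.ForcesElem A p) : T.ForcesElem A q :=
  ⟨⟨fun n r hr => h.1.1 n r (hr.trans hqp), fun n x y r hr => h.1.2 n x y r (hr.trans hqp)⟩,
    fun n r hr => h.2 n r (hr.trans hqp)⟩

theorem ForcesLE.mono (hqp : q ≤ p) (h : T.ForcesLE A A' p) : T.ForcesLE A A' q :=
  fun n r hr => h n r (hr.trans hqp)

theorem ForcesMemG.mono {s : T.Mathias H} (hqp : q ≤ p) (h : T.ForcesMemG A s p) :
    T.ForcesMemG A s q :=
  ⟨h.1.mono hqp, fun r hr => h.2 r (hr.trans hqp)⟩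

theorem forcesLE_check : T.ForcesLE A (.check Q (T.r B)) p ↔
    ∀ n, ∀ q ≤ p, ∃ r ≤ q, ∃ b ∈ T.below B, A.ForcesVal n b r := by
  constructor
  · intro h n q hq
    obtain ⟨r, hr, m, b, a, hb, ha, hle⟩ := h n q hq
    rw [SeqName.forcesVal_check] at ha
    exact ⟨r, hr, b, ⟨m, ha ▸ hle⟩, hb⟩
  · intro h n q hq
    obtain ⟨r, hr, b, ⟨m, hm⟩, hb⟩ := h n q hq
    exact ⟨r, hr, m, b, T.r B m, hb, SeqName.forcesVal_check.2 rfl, hm⟩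

theorem ForcesLE.trans_check (hT : T.IsClosedRamsey) (hA : T.ForcesElem A p)
    (h : T.ForcesLE A' A p) (h' : T.ForcesLE A (.check Q (T.r B)) p) :
    T.ForcesLE A' (.check Q (T.r B)) p := by
  rw [forcesLE_check] at h' ⊢
  intro n q hq
  obtain ⟨r, hr, m, b, a, hb, ha, hle⟩ := h n q hq
  obtain ⟨r', hr', a', ⟨k, hk⟩, ha'⟩ := h' m r (hr.trans hq)
  obtain rfl := hA.1.2 m a a' r' (hr'.trans (hr.trans hq)) (ha.mono hr') ha'
  exact ⟨r', hr'.trans hr, b, ⟨k, hT.a2.leFin_trans _ _ _ hle hk⟩, hb.mono hr'⟩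

theorem ForcesElem.mem_below (hA : T.ForcesElem A p) (h : T.ForcesLE A (.check Q (T.r B)) p)
    (hb : A.ForcesVal n b p) : b ∈ T.below B := by
  obtain ⟨r, hr, b', hb', hv⟩ := forcesLE_check.1 h n p le_rfl
  obtain rfl := hA.1.2 n b b' r hr (hb.mono hr) hv
  exact hb'

/-- Densely many conditions decide an initial segment of `A` that prolongs a decided one. -/
theorem ForcesElem.exists_r (hA : T.ForcesElem A p) (hb : A.ForcesVal n b p) (hnm : n ≤ m) :
    ∃ r ≤ p, ∃ C, T.r C n = b ∧ ∀ k ≤ m, A.ForcesVal k (T.r C k) r := by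
  obtain ⟨r, hr, C, hC⟩ := hA.2 m p le_rfl
  exact ⟨r, hr, C, hA.1.2 n _ _ r hr (hC n hnm) (hb.mono hr), hC⟩

theorem ForcesElem.lh_eq (hT : T.IsClosedRamsey) (hA : T.ForcesElem A p)
    (hb : A.ForcesVal n b p) : T.lh b = n := by
  obtain ⟨_, _, C, rfl, -⟩ := hA.exists_r hb le_rfl
  exact hT.lh_r C n

/-- A decided initial segment of `A` extending the stem is below the side, so A3 mod `H` prolongs it
to a ground model element of the neighbourhood. Inclusions between neighbourhoods thereby transfer
to the extension. -/
theorem ForcesMemG.exists_mem_nbhd (hT : T.IsClosedRamsey) (hH : T.IsCoideal H)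
    (hA : T.ForcesElem A p) {s : T.Mathias H} (hs : T.ForcesMemG A s p) (n : ℕ) :
    ∃ r ≤ p, ∃ F ∈ T.nbhd s.stem s.side, ∀ k ≤ n, A.ForcesVal k (T.r F k) r := by
  obtain ⟨r₁, hr₁, n₀, hv⟩ := hs.2 p le_rfl
  obtain ⟨r₂, hr₂, C, hCs, hC⟩ := (hA.mono hr₁).exists_r hv (le_max_right n n₀)
  have hr := hr₂.trans hr₁
  have hbelow := (hA.mono hr).mem_below (hs.1.mono hr) (hC _ le_rfl)
  obtain ⟨F, -, hF⟩ := exists_mem_nbhd_inter hT hH s.side_mem hbelow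
  have hFC := (hT.mem_nbhd.1 hF).2
  rw [hT.lh_r] at hFC
  refine ⟨r₂, hr, F, mem_nbhd_of_initial hT (initial_of_r hCs rfl (le_max_right _ _)) hF,
    fun k hk => ?_⟩
  have hk' : k ≤ max n n₀ := hk.trans (le_max_left _ _)
  rw [hT.r_eq_of_le hFC hk']
  exact hC k hk'

/-- The inclusion `[s] ⊆ [t]` persists to the generic extension. -/
theorem ForcesMemG.upward (hT : T.IsClosedRamsey) (hH : T.IsCoideal H) (hA : T.ForcesElem A p)
    {s t : T.Mathias H} (hst : s ≤ t) (hs : T.ForcesMemG A s p) : T.ForcesMemG A t p := by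
  refine ⟨forcesLE_check.2 fun n q hq => ?_, fun q hq => ?_⟩
  · obtain ⟨r, hr, F, hF, hv⟩ := (hs.mono hq).exists_mem_nbhd hT hH (hA.mono hq) n
    exact ⟨r, hr, _, r_mem_below hT (hst hF).1 n, hv n le_rfl⟩
  · obtain ⟨r, hr, F, hF, hv⟩ := (hs.mono hq).exists_mem_nbhd hT hH (hA.mono hq) (T.lh t.stem)
    have := hv _ le_rfl
    rw [(hT.mem_nbhd.1 (hst hF)).2] at this
    exact ⟨r, hr, _, this⟩

/-- Capturing is absolute. -/
theorem Captured.exists_forcesVal (hT : T.IsClosedRamsey) {P : AR → R → Prop}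
    (h : T.Captured P B c) : ∀ {p : Q}, T.ForcesElem A p → T.ForcesLE A (.check Q (T.r B)) p →
      A.ForcesVal (T.lh c) c p → ∃ r ≤ p, ∃ d, P d B ∧ A.ForcesVal (T.lh d) d r := by
  induction h with
  | base c h => exact fun {p} _ _ hc => ⟨p, le_rfl, c, h, hc⟩
  | step c _ ih =>
    intro p hA hle hc
    obtain ⟨r, hr, C, hCc, hC⟩ := hA.exists_r hc (Nat.le_succ _)
    have hv := hC _ le_rfl
    have hlh := hT.lh_r C (T.lh c + 1)
    obtain ⟨r', hr', hd⟩ := ih (T.r C (T.lh c + 1))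
      ⟨⟨(hA.mono hr).mem_below (hle.mono hr) hv, initial_of_r hCc rfl (by omega)⟩, hlh⟩
      (hA.mono hr) (hle.mono hr) (by rwa [hlh])
    exact ⟨r', hr'.trans hr, hd⟩

/-- It is dense to be below `s` or to force that the generic sequence is not in `[s]`. -/
theorem exists_le_or_forces_notMemG (hT : T.IsClosedRamsey) (hH : T.IsCoideal H)
    (hsel : T.Semiselective H) (hA : T.ForcesElem A p) (s u : T.Mathias H) :
    ∃ t ≤ u, t ≤ s ∨ ∀ q ≤ p, T.ForcesMemG A t q → ¬ T.ForcesMemG A s q := by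
  obtain ⟨F, hFH, hF⟩ := exists_mem_nbhd_inter hT hH u.side_mem u.stem_mem
  have hFu := (hT.mem_nbhd.1 hF).2
  -- Long enough for the new stem to settle whether `s.stem` is an initial segment.
  set N := max (T.lh u.stem) (T.lh s.stem) with hN
  -- Capturing here means that every sequence through the new stem and below `E` has an
  -- approximation that is not below `s.side`.
  obtain ⟨E, hEH, hE, hcap⟩ := exists_captured_or hT hH hsel (P := fun x _ => x ∉ T.below s.side)
    (fun _ _ _ _ _ _ h => h) hFH (r_mem_below hT (hT.le_refl F) N)
  have hEN := (hT.mem_nbhd.1 hE).2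
  rw [hT.lh_r] at hEN
  refine ⟨⟨T.r F N, E, hEH, mem_below_of_mem_nbhd hT ⟨hT.le_refl E, hE.2⟩⟩, ?_, ?_⟩
  · exact fun G hG => nbhd_subset_nbhd_of_le hT (hT.le_trans _ _ _ hE.1 hF.1)
      (mem_nbhd_of_initial hT (initial_of_r hFu rfl (le_max_left _ _)) hG)
  by_cases hFs : T.r F (T.lh s.stem) = s.stem
  · refine hcap.symm.imp (fun hbelow G hG => ?_) fun hcap q hq hq1 hq2 => ?_
    · have hGN := hT.mem_nbhd.1 hG
      have hGs : T.r G (T.lh s.stem) = s.stem :=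
        hT.r_of_initial (initial_of_r hFs rfl (le_max_right _ _)) hGN.2
      refine ⟨(hT.a2.le_iff _ _).2 fun n => ?_, _, hGs⟩
      have hG' : T.r G N = T.r F N := by
        have := hGN.2
        rwa [hT.lh_r] at this
      refine mem_below_of_initial hT (T.initial_r G (le_max_left n N)) ?_
      have hx : T.r G (max n N) ∈ T.belowNbhd (T.r F N) E :=
        ⟨r_mem_below hT hGN.1 _, initial_of_r hG' rfl (le_max_right _ _)⟩
      obtain ⟨C, hCH, hC⟩ := exists_mem_nbhd_inter hT hH hEH hx.1
      exact not_not.1 (hbelow _ hx C hCH hC)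
    · have hAq := hA.mono hq
      obtain ⟨r, hr, n, hv⟩ := hq1.2 q le_rfl
      have hlh := (hAq.mono hr).lh_eq hT hv
      obtain ⟨r', hr', d, hd, hvd⟩ := hcap.exists_forcesVal hT (hAq.mono hr) (hq1.1.mono hr)
        (by rwa [hlh])
      exact hd ((hAq.mono (hr'.trans hr)).mem_below (hq2.1.mono (hr'.trans hr)) hvd)
  · refine Or.inr fun q hq hq1 hq2 => hFs ?_
    have hAq := hA.mono hq
    obtain ⟨r, hr, G, hG, hv⟩ := hq1.exists_mem_nbhd hT hH hAq (T.lh s.stem)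
    obtain ⟨r', hr', G', hG', hv'⟩ :=
      (hq2.mono hr).exists_mem_nbhd hT hH (hAq.mono hr) (T.lh s.stem)
    have h1 := hAq.1.2 _ _ _ r' (hr'.trans hr) ((hv _ le_rfl).mono hr') (hv' _ le_rfl)
    have h2 : T.r G (T.lh (T.r F N)) = T.r F N := (hT.mem_nbhd.1 hG).2
    rw [hT.lh_r] at h2
    rw [← hT.r_eq_of_le h2 (le_max_right _ _), h1, (hT.mem_nbhd.1 hG').2]

/-- Densely many conditions decide an initial segment of `A` that is not below `r_k(B)`, `k < m`. -/
theorem exists_forcesVal_le_depth (hT : T.IsClosedRamsey) (hA : T.ForcesElem A p)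
    (hle : T.ForcesLE A (.check Q (T.r B)) p) (m : ℕ) :
    ∃ r ≤ p, ∃ c ∈ T.below B, m ≤ T.depth B c ∧ A.ForcesVal (T.lh c) c r := by
  -- By A2 only finitely many approximations have depth less than `m`, so their lengths are bounded
  -- by some `N`; the approximation of length `N + 1` escapes them.
  have hfin : (⋃ k ∈ Set.Iio m, {x | T.leFin x (T.r B k)}).Finite :=
    (Set.finite_Iio m).biUnion fun k _ => hT.a2.finite _
  obtain ⟨N, hN⟩ := (hfin.image T.lh).bddAbove
  obtain ⟨r, hr, c, hc, hv⟩ := forcesLE_check.1 hle (N + 1) p le_rfl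
  have hlh := (hA.mono hr).lh_eq hT hv
  refine ⟨r, hr, c, hc, ?_, by rwa [hlh]⟩
  by_contra! hlt
  have : T.lh c ≤ N := hN ⟨c, Set.mem_biUnion hlt (leFin_r_depth hc), rfl⟩
  omega

/-- Densely many conditions `(r_m(C), C)` capture a given dense set of conditions at every
approximation that is not below `r_k(C)`, `k < m`. -/
theorem exists_le_forall_captured (hT : T.IsClosedRamsey) (hH : T.IsCoideal H)
    (hsel : T.Semiselective H) {D : Set (T.Mathias H)} (hD : ∀ s, ∃ t ≤ s, t ∈ D)
    (u : T.Mathias H) :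
    ∃ t ≤ u, ∃ m, ∀ c ∈ T.below t.side, m ≤ T.depth t.side c →
      T.Captured (fun c B => ∃ (hB : B ∈ H) (hc : c ∈ T.below B), ∃ d ∈ D, ⟨c, B, hB, hc⟩ ≤ d)
        t.side c := by
  have hP : T.Hereditary H
      fun c B => ∃ (hB : B ∈ H) (hc : c ∈ T.below B), ∃ d ∈ D, ⟨c, B, hB, hc⟩ ≤ d := by
    rintro c B B' hB' hc hs ⟨_, _, d, hd, hle⟩
    exact ⟨hB', hc, d, hd, hs.trans hle⟩
  obtain ⟨F, hFH, hF⟩ := exists_mem_nbhd_inter hT hH u.side_mem u.stem_mem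
  have hFu := (hT.mem_nbhd.1 hF).2
  obtain ⟨C, hCH, hC, hcap⟩ := exists_forall_le_depth hT hH hsel (Captured.hereditary hT hH hP)
    -- Capture is dense: otherwise refine `(c, B)` into `D`, then to a condition whose stem extends
    -- `c`; it contradicts the second alternative.
    (fun A hA c hc => by
      obtain ⟨B, hBH, hB, h | h⟩ := exists_captured_or hT hH hsel hP hA hc
      · exact ⟨B, hBH, hB, h⟩
      · obtain ⟨d, hd, hdD⟩ :=
          hD ⟨c, B, hBH, mem_below_of_mem_nbhd hT ⟨hT.le_refl B, hB.2⟩⟩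
        obtain ⟨E, hEH, hE, b, hb, hEB, hdb⟩ :=
          exists_refinement hT hH d.side_mem d.stem_mem hd
        refine (h b hb E hEH hEB ⟨hEH, mem_below_of_mem_nbhd hT ⟨hT.le_refl E, hEB.2⟩, d, hdD,
          fun G hG => ?_⟩).elim
        exact nbhd_subset_nbhd_of_le hT hE.1 (mem_nbhd_of_initial hT hdb hG))
    hFH (T.lh u.stem)
  rw [hFu] at hC
  exact ⟨⟨u.stem, C, hCH, mem_below_of_mem_nbhd hT ⟨hT.le_refl C, hC.2⟩⟩,
    nbhd_subset_nbhd_of_le hT (hT.le_trans _ _ _ hC.1 hF.1), _, hcap⟩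

/-- Genericity of `A` is applied only to the dense set of conditions that capture `D`. The filter
properties of `B` then come from `B` meeting dense sets and from transfer of inclusions. -/
theorem mathiasProperty (hT : T.IsClosedRamsey) (hH : T.IsCoideal H) (hsel : T.Semiselective H) :
    MathiasProperty.{u, w} T H := by
  intro Q _ A B p hA hB hBA
  have meets : ∀ D : Set (T.Mathias H), (∀ s, ∃ t ≤ s, t ∈ D) →
      ∀ q ≤ p, ∃ r ≤ q, ∃ s ∈ D, T.ForcesMemG B s r := by
    intro D hD q hq
    obtain ⟨r, hr, s, ⟨m, hm⟩, hs⟩ :=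
      hA.meets {t | _} (exists_le_forall_captured hT hH hsel hD) q hq
    have hrp := hr.trans hq
    have hBs := (hBA.mono hrp).trans_check hT (hA.elem.mono hrp) hs.1
    -- `B` need not start with the stem of `s`; it suffices that `B` is below the side and has an
    -- approximation of depth at least `m`.
    obtain ⟨r₁, hr₁, c, hc, hmc, hv⟩ := exists_forcesVal_le_depth hT (hB.mono hrp) hBs m
    obtain ⟨r₂, hr₂, e, ⟨he, he', d, hd, hle⟩, hv'⟩ := (hm c hc hmc).exists_forcesVal hT
      (hB.mono (hr₁.trans hrp)) (hBs.mono hr₁) hv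
    have hr₂r := hr₂.trans hr₁
    refine ⟨r₂, hr₂r.trans hr, d, hd, ForcesMemG.upward hT hH (hB.mono (hr₂r.trans hrp)) hle ?_⟩
    exact ⟨hBs.mono hr₂r, fun q' hq' => ⟨q', le_rfl, _, hv'.mono hq'⟩⟩
  have upward : ∀ s t : T.Mathias H, s ≤ t → ∀ q ≤ p, T.ForcesMemG B s q → T.ForcesMemG B t q :=
    fun s t hst q hq hs => hs.upward hT hH (hB.mono hq) hst
  refine ⟨hB, fun q hq => ?_, upward, fun s t q hq hs ht q' hq' => ?_, meets⟩
  · obtain ⟨r, hr, s, -, hs⟩ := meets Set.univ (fun s => ⟨s, le_rfl, trivial⟩) q hq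
    exact ⟨r, hr, s, hs⟩
  · let out (s t : T.Mathias H) : Prop := ∀ q ≤ p, T.ForcesMemG B t q → ¬ T.ForcesMemG B s q
    -- A condition met by `B` cannot exclude `s` or `t`, as `B` is in both neighbourhoods; so it
    -- lies below both.
    obtain ⟨r, hr, c, ⟨hcs, hct⟩, hc⟩ := meets {c | (c ≤ s ∨ out s c) ∧ (c ≤ t ∨ out t c)}
      (fun u => by
        obtain ⟨c₁, hc₁, h₁⟩ := exists_le_or_forces_notMemG hT hH hsel hB s u
        obtain ⟨c₂, hc₂, h₂⟩ := exists_le_or_forces_notMemG hT hH hsel hB t c₁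
        exact ⟨c₂, hc₂.trans hc₁, h₁.imp hc₂.trans
          fun h q hq hc => h q hq (upward _ _ hc₂ q hq hc), h₂⟩)
      q' (hq'.trans hq)
    have hrq := hr.trans hq'
    exact ⟨r, hr, c, hcs.resolve_right fun h => h r (hrq.trans hq) hc (hs.mono hrq),
      hct.resolve_right fun h => h r (hrq.trans hq) hc (ht.mono hrq), hc⟩

end Extension

end RamseyTriple

theorem mainTheorem9 {R AR : Type u} (T : RamseyTriple R AR) (hT : T.IsClosedRamsey)
    (H : Set R) (hH : T.IsCoideal H) (hsel : T.Semiselective H) :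
    RamseyTriple.MathiasProperty.{u, w} T H ∧ T.PrikryProperty H :=
  ⟨RamseyTriple.mathiasProperty hT hH hsel, RamseyTriple.prikryProperty hT hH hsel⟩
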